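/- Let $d\ge 2$ and $n$ be natural numbers and let $G=(E,D,\partial D)$ be the $d$-dimensional hypercubic lattice graph: the interior nodes are $D=\{x\in\mathbb Z^d: 1\le x_i\le n \text{ for all } i\}$, the boundary nodes are $\partial D=\{p\in\mathbb Z^d:\min_{q\in D}\|q-p\|_{\ell^1}=1\}$, and $E$ consists of the unordered pairs $\{p,q\}$ of nodes in $D\cup\partial D$ with $\|p-q\|_{\ell^1}=1$ and $\{p,q\}\not\subseteq\partial D$. A conductivity is a function $\gamma:E\to(0,\infty)$. Writing $\mathcal N(p)$ for the set of neighbours of $p$, for every $\varphi\in\mathbb R^{\partial D}$ there is a unique $u\in\mathbb R^{D\cup\partial D}$ with $\sum_{q\in\mathcal N(p)}\gamma_{qp}(u_q-u_p)=0$ for all $p\in D$ and $u_p=\varphi_p$ for all $p\in\partial D$; the Dirichlet-to-Neumann matrix $\Lambda_\gamma$ is the matrix of the linear map $\mathbb R^{\partial D}\to\mathbb R^{\partial D}$, $\varphi\mapsto\psi$, with $\psi_p=\sum_{q\in\mathcal N(p)}\gamma_{qp}(u_q-u_p)$ for $p\in\partial D$. Theorem (Uniqueness). The matrix $\Lambda_\gamma$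 uniquely determines the conductivity $\gamma$: if $\gamma_1,\gamma_2:E\to(0,\infty)$ are conductivities with $\Lambda_{\gamma_1}=\Lambda_{\gamma_2}$, then $\gamma_1(e)=\gamma_2(e)$ for every edge $e\in E$. -/

import Mathlib

namespace GridCalderon

noncomputable section

/-- The `ℓ¹` distance between two points of `ℤ^d`. -/
def l1dist {d : ℕ} (p q : Fin d → ℤ) : ℤ := ∑ i, |p i - q i|

/-- Interior nodes `D`: the integer points with all coordinates in `{1, …, n}`. -/
def interior (d n : ℕ) : Set (Fin d → ℤ) := {x | ∀ i, 1 ≤ x i ∧ x i ≤ n}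

/-- Boundary nodes `∂D`: the integer points `p` with `min_{q ∈ D} ‖q - p‖_{ℓ¹} = 1`. -/
def boundary (d n : ℕ) : Set (Fin d → ℤ) :=
  {p | IsLeast ((fun q => l1dist q p) '' interior d n) 1}

/-- The nodes `D ∪ ∂D` of the grid graph. -/
abbrev Vertex (d n : ℕ) : Type := ↥(interior d n ∪ boundary d n)

/-- The grid graph: edges join nodes at `ℓ¹` distance `1` that are not both on the boundary. -/
def grid (d n : ℕ) : SimpleGraph (Vertex d n) where
  Adj p q := l1dist p.1 q.1 = 1 ∧ ¬ (p.1 ∈ boundary d n ∧ q.1 ∈ boundary d n)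
  symm := ⟨by
    rintro p q ⟨h, h'⟩
    refine ⟨?_, fun hh => h' ⟨hh.2, hh.1⟩⟩
    rw [← h]
    exact Finset.sum_congr rfl fun i _ => abs_sub_comm _ _⟩
  loopless := ⟨by
    rintro p ⟨h, -⟩
    simp [l1dist] at h⟩

/-- A conductivity: a positive real number on every (unordered) edge. -/
abbrev Conductivity (d n : ℕ) : Type :=
  {γ : ↥(grid d n).edgeSet → ℝ // ∀ e, 0 < γ e}

lemma abs_coord_le_l1dist {d : ℕ} (p q : Fin d → ℤ) (i : Fin d) :
    |p i - q i| ≤ l1dist p q :=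
  Finset.single_le_sum (f := fun i => |p i - q i|) (fun _ _ => abs_nonneg _) (Finset.mem_univ i)

lemma coord_mem_of_mem {d n : ℕ} {p : Fin d → ℤ} (hp : p ∈ interior d n ∪ boundary d n)
    (i : Fin d) : 0 ≤ p i ∧ p i ≤ n + 1 := by
  rcases hp with hp | hp
  · have := hp i
    omega
  · obtain ⟨q, hq, h⟩ := hp.1
    have h1 := abs_coord_le_l1dist q p i
    have h2 := hq i
    have h3 : l1dist q p = 1 := h
    rw [h3, abs_le] at h1
    omega

lemma finite_nodes (d n : ℕ) : (interior d n ∪ boundary d n).Finite := by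
  refine (Set.finite_Icc (fun _ : Fin d => (0 : ℤ)) (fun _ => (n : ℤ) + 1)).subset ?_
  intro p hp
  exact ⟨fun i => (coord_mem_of_mem hp i).1, fun i => (coord_mem_of_mem hp i).2⟩

instance instFintypeVertex (d n : ℕ) : Fintype (Vertex d n) := (finite_nodes d n).fintype

instance instFintypeBoundary (d n : ℕ) : Fintype ↥(boundary d n) :=
  ((finite_nodes d n).subset Set.subset_union_right).fintype

instance instFintypeNeighborSet {d n : ℕ} (p : Vertex d n) :
    Fintype ↥((grid d n).neighborSet p) := Fintype.ofFinite _

/-- A boundary node, seen as a node of the graph. -/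
def ofBoundary {d n : ℕ} (p : ↥(boundary d n)) : Vertex d n := ⟨p.1, Or.inr p.2⟩

/-- The operator `u ↦ (p ↦ ∑_{q ∈ N(p)} γ_{qp} (u_q - u_p))`. At interior nodes this is the
discrete Laplacian `Δ_γ u`, at boundary nodes it is the boundary current. -/
def netCurrent {d n : ℕ} (γ : Conductivity d n) : (Vertex d n → ℝ) →ₗ[ℝ] (Vertex d n → ℝ) where
  toFun u p := ∑ q : ↥((grid d n).neighborSet p), γ.1 ⟨s(p, q.1), q.2⟩ * (u q.1 - u p)
  map_add' u v := by
    funext p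
    simp only [Pi.add_apply, ← Finset.sum_add_distrib]
    exact Finset.sum_congr rfl fun q _ => by ring
  map_smul' c u := by
    funext p
    simp only [Pi.smul_apply, smul_eq_mul, RingHom.id_apply, Finset.mul_sum]
    exact Finset.sum_congr rfl fun q _ => by ring

/-- `u` solves the Dirichlet problem: `(Δ_γ u)_p = 0` for `p ∈ D` and `u_p = φ_p` for
`p ∈ ∂D`. -/
def IsDirichletSolution {d n : ℕ} (γ : Conductivity d n) (φ : ↥(boundary d n) → ℝ)
    (u : Vertex d n → ℝ) : Prop :=
  (∀ p : Vertex d n, p.1 ∈ interior d n → netCurrent γ u p = 0) ∧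
    ∀ p : ↥(boundary d n), u (ofBoundary p) = φ p

/-- The Neumann map `D_γ`: the boundary current of a potential. -/
def neumannMap {d n : ℕ} (γ : Conductivity d n) :
    (Vertex d n → ℝ) →ₗ[ℝ] (↥(boundary d n) → ℝ) :=
  (LinearMap.funLeft ℝ ℝ ofBoundary).comp (netCurrent γ)

lemma not_mem_interior_of_mem_boundary {d n : ℕ} {p : Fin d → ℤ} (hp : p ∈ boundary d n) :
    p ∉ interior d n := by
  intro h
  have := hp.2 ⟨p, h, rfl⟩
  simp [l1dist] at this

/-- The node `p + e_0` next to an interior node `p`, in the positive first direction. -/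
lemma exists_next {d n : ℕ} [NeZero d] (p : Vertex d n) (hp : p.1 ∈ interior d n) :
    ∃ q : Vertex d n, (grid d n).Adj p q ∧ q.1 0 = p.1 0 + 1 := by
  classical
  set r : Fin d → ℤ := Function.update p.1 0 (p.1 0 + 1) with hr
  have hd : l1dist p.1 r = 1 := by
    unfold l1dist
    rw [Finset.sum_eq_single (0 : Fin d)]
    · simp [hr]
    · intro i _ hi
      simp [hr, Function.update_of_ne hi]
    · simp
  have hmem : r ∈ interior d n ∪ boundary d n := by
    by_cases h : r ∈ interior d n
    · exact Or.inl h
    · refine Or.inr ⟨⟨p.1, hp, hd⟩, ?_⟩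
      rintro _ ⟨q, hq, rfl⟩
      by_contra hlt
      apply h
      have : q = r := by
        funext i
        have h1 : |q i - r i| ≤ 0 := by
          have := abs_coord_le_l1dist q r i
          simp only [not_le] at hlt
          omega
        have := abs_nonpos_iff.mp h1
        omega
      exact this ▸ hq
  refine ⟨⟨r, hmem⟩, ⟨hd, fun hh => not_mem_interior_of_mem_boundary hh.1 hp⟩, ?_⟩
  simp [hr]

/-- Maximum principle: a potential that is harmonic in `D` and nonpositive on `∂D` is
nonpositive. -/
lemma nonpos_of_harmonic {d n : ℕ} [NeZero d] (γ : Conductivity d n) (u : Vertex d n → ℝ)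
    (h0 : ∀ p : Vertex d n, p.1 ∈ interior d n → netCurrent γ u p = 0)
    (hb : ∀ p : ↥(boundary d n), u (ofBoundary p) ≤ 0) (x : Vertex d n) : u x ≤ 0 := by
  obtain ⟨p, -, hp⟩ := Finset.exists_max_image Finset.univ
    (fun p : Vertex d n => toLex (u p, p.1 0)) ⟨x, Finset.mem_univ x⟩
  have hmax : ∀ q, u q ≤ u p ∧ (u q = u p → q.1 0 ≤ p.1 0) := by
    intro q
    have := hp q (Finset.mem_univ q)
    rw [Prod.Lex.toLex_le_toLex] at this
    rcases this with h | ⟨h, h'⟩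
    · exact ⟨h.le, fun he => absurd he h.ne⟩
    · exact ⟨h.le, fun _ => h'⟩
  by_cases hpi : p.1 ∈ interior d n
  · exfalso
    obtain ⟨q, hq, hq0⟩ := exists_next p hpi
    have hsum := h0 p hpi
    have hz := (Finset.sum_eq_zero_iff_of_nonpos
      (f := fun q : ↥((grid d n).neighborSet p) => γ.1 ⟨s(p, q.1), q.2⟩ * (u q.1 - u p))
      (s := Finset.univ) (fun r _ => mul_nonpos_of_nonneg_of_nonpos (γ.2 _).le
        (sub_nonpos.mpr (hmax r.1).1))).mp hsum ⟨q, hq⟩ (Finset.mem_univ _)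
    have he : u q = u p := by
      rcases mul_eq_zero.mp hz with h | h
      · exact absurd h (γ.2 _).ne'
      · linarith
    have := (hmax q).2 he
    omega
  · have hpb : p.1 ∈ boundary d n := p.2.resolve_left hpi
    exact (hmax x).1.trans (hb ⟨p.1, hpb⟩)

lemma eq_zero_of_isDirichletSolution_zero {d n : ℕ} [NeZero d] (γ : Conductivity d n)
    (u : Vertex d n → ℝ) (hu : IsDirichletSolution γ 0 u) : u = 0 := by
  funext x
  refine le_antisymm
    (nonpos_of_harmonic γ u hu.1 (fun p => (hu.2 p).le) x) ?_
  have := nonpos_of_harmonic γ (-u) (fun p hp => by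
    rw [map_neg, Pi.neg_apply, hu.1 p hp, neg_zero]) (fun p => by
    rw [Pi.neg_apply, hu.2 p]; simp) x
  simpa using this

lemma IsDirichletSolution.add {d n : ℕ} {γ : Conductivity d n} {φ ψ : ↥(boundary d n) → ℝ}
    {u v : Vertex d n → ℝ} (hu : IsDirichletSolution γ φ u) (hv : IsDirichletSolution γ ψ v) :
    IsDirichletSolution γ (φ + ψ) (u + v) :=
  ⟨fun p hp => by rw [map_add, Pi.add_apply, hu.1 p hp, hv.1 p hp, add_zero],
    fun p => by rw [Pi.add_apply, Pi.add_apply, hu.2 p, hv.2 p]⟩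

lemma IsDirichletSolution.smul {d n : ℕ} {γ : Conductivity d n} {φ : ↥(boundary d n) → ℝ}
    {u : Vertex d n → ℝ} (c : ℝ) (hu : IsDirichletSolution γ φ u) :
    IsDirichletSolution γ (c • φ) (c • u) :=
  ⟨fun p hp => by rw [map_smul, Pi.smul_apply, hu.1 p hp, smul_zero],
    fun p => by rw [Pi.smul_apply, Pi.smul_apply, hu.2 p]⟩

lemma IsDirichletSolution.unique {d n : ℕ} [NeZero d] {γ : Conductivity d n}
    {φ : ↥(boundary d n) → ℝ} {u v : Vertex d n → ℝ} (hu : IsDirichletSolution γ φ u)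
    (hv : IsDirichletSolution γ φ v) : u = v := by
  have h := hu.add (hv.smul (-1))
  have h0 : φ + (-1 : ℝ) • φ = 0 := by simp
  rw [h0] at h
  have := eq_zero_of_isDirichletSolution_zero γ _ h
  simpa [add_neg_eq_zero] using this

/-- Unique solvability of the Dirichlet problem. -/
theorem existsUnique_isDirichletSolution {d n : ℕ} [NeZero d] (γ : Conductivity d n)
    (φ : ↥(boundary d n) → ℝ) : ∃! u, IsDirichletSolution γ φ u := by
  classical
  let A : (Vertex d n → ℝ) →ₗ[ℝ] (Vertex d n → ℝ) := LinearMap.pi fun p =>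
    if p.1 ∈ interior d n then (LinearMap.proj p).comp (netCurrent γ) else LinearMap.proj p
  have hA1 : ∀ u p, p.1 ∈ interior d n → A u p = netCurrent γ u p := by
    intro u p hp
    simp [A, hp]
  have hA2 : ∀ u (p : ↥(boundary d n)), A u (ofBoundary p) = u (ofBoundary p) := by
    intro u p
    have : (ofBoundary p).1 ∉ interior d n := not_mem_interior_of_mem_boundary p.2
    simp [A, this]
  have hinj : Function.Injective A := by
    rw [injective_iff_map_eq_zero]
    intro u hu
    refine eq_zero_of_isDirichletSolution_zero γ u ⟨fun p hp => ?_, fun p => ?_⟩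
    · rw [← hA1 u p hp, hu]; rfl
    · rw [← hA2 u p, hu]; rfl
  obtain ⟨u, hu⟩ := (LinearMap.injective_iff_surjective.mp hinj)
    (fun p => if h : p.1 ∈ boundary d n then φ ⟨p.1, h⟩ else 0)
  have hs : IsDirichletSolution γ φ u := by
    refine ⟨fun p hp => ?_, fun p => ?_⟩
    · have hb : p.1 ∉ boundary d n := fun h => not_mem_interior_of_mem_boundary h hp
      rw [← hA1 u p hp, hu]
      simp [hb]
    · rw [← hA2 u p, hu]
      simp [ofBoundary]
  exact ⟨u, hs, fun v hv => hv.unique hs⟩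

/-- The solution operator `S_γ`, mapping `φ` to the unique solution of the Dirichlet problem. -/
def solutionMap {d n : ℕ} [NeZero d] (γ : Conductivity d n) :
    (↥(boundary d n) → ℝ) →ₗ[ℝ] (Vertex d n → ℝ) where
  toFun φ := (existsUnique_isDirichletSolution γ φ).choose
  map_add' φ ψ := (existsUnique_isDirichletSolution γ (φ + ψ)).choose_spec.1.unique
    ((existsUnique_isDirichletSolution γ φ).choose_spec.1.add
      (existsUnique_isDirichletSolution γ ψ).choose_spec.1)
  map_smul' c φ := (existsUnique_isDirichletSolution γ (c • φ)).choose_spec.1.unique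
    ((existsUnique_isDirichletSolution γ φ).choose_spec.1.smul c)

/-- The Dirichlet-to-Neumann matrix `Λ_γ`, the matrix of `D_γ ∘ S_γ`. -/
def dtnMatrix {d n : ℕ} [NeZero d] (γ : Conductivity d n) :
    Matrix ↥(boundary d n) ↥(boundary d n) ℝ :=
  LinearMap.toMatrix' ((neumannMap γ).comp (solutionMap γ))

end

end GridCalderon

/-! If the matrices agree, Green's identity yields an Alessandrini identity: for `u` harmonic for
`γ₁` and `v` harmonic for `γ₂`, the sum over edges of (γ₁ - γ₂) du dv vanishes
(`energy_eq_of_dtnMatrix_eq`). It remains to find, for each edge, a pair `u`, `v` to which no other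
unsettled edge contributes (`pairCond_eq_of_isolated`).

Such potentials come from marching. The equation at an interior node q determines the value at q + σ
e_i from earlier layers, and values at nodes not of this form are free. Through any node passes a
wall x_j - σ x_i = c, with j ≠ i; some harmonic potential is nonzero at that node, vanishes beyond
the wall, and on the wall lives on one diagonal line (`exists_isHarmonic_behind`).

With σ = 1 for `u` and σ = -1 for `v`, only edges touching both half-spaces x_j ≤ x_i - a and x_j ≤
b - x_i contribute. By induction on b - a, edges of smaller wedges are settled, and the remaining
ones sit at the top: they join the two walls in direction e_i (b - a odd), or run along the ridge or
up from it (b - a even). Each kind is isolated separately (`AgreesBelow.pairCond_eq`). -/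

namespace GridCalderon

noncomputable section

variable {d n : ℕ}

/-! ### Green's identity and the comparison of energies -/

open Classical in
/-- The conductivity between two nodes, extended by zero to pairs that are not edges. -/
def pairCond (γ : Conductivity d n) (p q : Vertex d n) : ℝ :=
  if h : (grid d n).Adj p q then γ.1 ⟨s(p, q), h⟩ else 0

lemma pairCond_of_adj (γ : Conductivity d n) {p q : Vertex d n} (h : (grid d n).Adj p q) :
    pairCond γ p q = γ.1 ⟨s(p, q), h⟩ := dif_pos h

lemma pairCond_pos (γ : Conductivity d n) {p q : Vertex d n} (h : (grid d n).Adj p q) :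
    0 < pairCond γ p q := by
  rw [pairCond_of_adj γ h]
  exact γ.2 _

lemma pairCond_comm (γ : Conductivity d n) (p q : Vertex d n) :
    pairCond γ p q = pairCond γ q p := by
  by_cases h : (grid d n).Adj p q
  · rw [pairCond_of_adj γ h, pairCond_of_adj γ h.symm]
    exact congrArg γ.1 (Subtype.ext Sym2.eq_swap)
  · have h' : ¬ (grid d n).Adj q p := fun h' => h h'.symm
    simp [pairCond, h, h']

lemma netCurrent_apply (γ : Conductivity d n) (u : Vertex d n → ℝ) (p : Vertex d n) :
    netCurrent γ u p = ∑ q, pairCond γ p q * (u q - u p) := by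
  classical
  rw [← Finset.sum_subset (Finset.subset_univ ((grid d n).neighborSet p).toFinset),
    Finset.sum_subtype (p := fun q => q ∈ (grid d n).neighborSet p) _ (by simp)]
  · exact Finset.sum_congr rfl fun q _ => by rw [pairCond_of_adj γ q.2]
  · intro q _ hq
    have : ¬ (grid d n).Adj p q := by simpa using hq
    simp [pairCond, this]

/-- Harmonicity at every interior node. -/
def IsHarmonic (γ : Conductivity d n) (u : Vertex d n → ℝ) : Prop :=
  ∀ p : Vertex d n, p.1 ∈ interior d n → netCurrent γ u p = 0

/-- Summation by parts: symmetrise in `p` and `q`. The factor 2 appears because ordered pairs count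
every edge twice. -/
lemma two_mul_sum_mul_netCurrent (γ : Conductivity d n) (u v : Vertex d n → ℝ) :
    2 * ∑ p, v p * netCurrent γ u p =
      -∑ p, ∑ q, pairCond γ p q * ((u q - u p) * (v q - v p)) := by
  have h1 : ∑ p, v p * netCurrent γ u p = ∑ p, ∑ q, v p * (pairCond γ p q * (u q - u p)) := by
    simp only [netCurrent_apply, Finset.mul_sum]
  have h2 : ∑ p, v p * netCurrent γ u p = ∑ p, ∑ q, v q * (pairCond γ p q * (u p - u q)) := by
    rw [h1, Finset.sum_comm]
    simp only [pairCond_comm γ]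
  rw [two_mul]
  nth_rewrite 1 [h1]
  rw [h2, ← Finset.sum_add_distrib, ← Finset.sum_neg_distrib]
  refine Finset.sum_congr rfl fun p _ => ?_
  rw [← Finset.sum_add_distrib, ← Finset.sum_neg_distrib]
  exact Finset.sum_congr rfl fun q _ => by ring

lemma isDirichletSolution_solutionMap [NeZero d] (γ : Conductivity d n)
    (φ : ↥(boundary d n) → ℝ) : IsDirichletSolution γ φ (solutionMap γ φ) :=
  (existsUnique_isDirichletSolution γ φ).choose_spec.1

/-- Two conductivities with the same Dirichlet-to-Neumann matrix have the same mixed energies. -/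
lemma energy_eq_of_dtnMatrix_eq [NeZero d] {γ₁ γ₂ : Conductivity d n}
    (h : dtnMatrix γ₁ = dtnMatrix γ₂) {u v : Vertex d n → ℝ}
    (hu : IsHarmonic γ₁ u) (hv : IsHarmonic γ₂ v) :
    ∑ p, ∑ q, pairCond γ₁ p q * ((u q - u p) * (v q - v p)) =
      ∑ p, ∑ q, pairCond γ₂ p q * ((u q - u p) * (v q - v p)) := by
  have hmap : (neumannMap γ₁).comp (solutionMap γ₁) = (neumannMap γ₂).comp (solutionMap γ₂) :=
    LinearMap.toMatrix'.injective h
  set φ : ↥(boundary d n) → ℝ := fun p => u (ofBoundary p) with hφ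
  have hu' : solutionMap γ₁ φ = u :=
    (isDirichletSolution_solutionMap γ₁ φ).unique ⟨hu, fun _ => rfl⟩
  have hw := isDirichletSolution_solutionMap γ₂ φ
  set w := solutionMap γ₂ φ with hwdef
  have hN : ∀ p, netCurrent γ₁ u p = netCurrent γ₂ w p := by
    intro p
    rcases p.2 with hp | hp
    · rw [hu p hp, hw.1 p hp]
    · have := congrFun (LinearMap.congr_fun hmap φ) ⟨p.1, hp⟩
      rw [LinearMap.comp_apply, LinearMap.comp_apply, hu', ← hwdef] at this
      exact this
  have hM : ∀ p, w p * netCurrent γ₂ v p = u p * netCurrent γ₂ v p := by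
    intro p
    rcases p.2 with hp | hp
    · rw [hv p hp, mul_zero, mul_zero]
    · have : w p = u p := hw.2 ⟨p.1, hp⟩
      rw [this]
  -- With E the energy sums: E₁(u, v) = E₂(w, v), since `u` and `w` have equal currents, and E₂(w,
  -- v) = E₂(u, v), since `w = u` on the boundary, where all current of `v` sits.
  have e1 := two_mul_sum_mul_netCurrent γ₁ u v
  have e2 := two_mul_sum_mul_netCurrent γ₂ w v
  have e3 := two_mul_sum_mul_netCurrent γ₂ v w
  have e4 := two_mul_sum_mul_netCurrent γ₂ v u
  simp only [hN] at e1
  simp only [hM] at e3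
  simp only [mul_comm (v _ - v _)] at e3 e4
  linarith

/-- If all edges but one contribute nothing to the difference of the mixed energies, then the
conductivities agree on the remaining edge. -/
lemma pairCond_eq_of_isolated [NeZero d] {γ₁ γ₂ : Conductivity d n}
    (h : dtnMatrix γ₁ = dtnMatrix γ₂) {u v : Vertex d n → ℝ}
    (hu : IsHarmonic γ₁ u) (hv : IsHarmonic γ₂ v) {p q : Vertex d n}
    (hup : u p ≠ u q) (hvp : v p ≠ v q)
    (hiso : ∀ r s, (grid d n).Adj r s → u r ≠ u s → v r ≠ v s →
      pairCond γ₁ r s ≠ pairCond γ₂ r s → (r = p ∧ s = q) ∨ (r = q ∧ s = p)) :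
    pairCond γ₁ p q = pairCond γ₂ p q := by
  classical
  by_contra hne
  have hE := energy_eq_of_dtnMatrix_eq h hu hv
  rw [← sub_eq_zero, ← Finset.sum_sub_distrib] at hE
  simp only [← Finset.sum_sub_distrib, ← sub_mul] at hE
  rw [← Fintype.sum_prod_type' (f := fun r s : Vertex d n =>
    (pairCond γ₁ r s - pairCond γ₂ r s) * ((u s - u r) * (v s - v r)))] at hE
  have hpq : p ≠ q := fun e => hup (by rw [e])
  rw [← Finset.sum_subset (Finset.subset_univ {(p, q), (q, p)}),
    Finset.sum_pair (by simp [hpq])] at hE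
  · simp only [pairCond_comm _ q p] at hE
    have : (pairCond γ₁ p q - pairCond γ₂ p q) * ((u q - u p) * (v q - v p)) = 0 := by
      linarith
    have h1 := sub_ne_zero.mpr hne
    have h2 := sub_ne_zero.mpr hup.symm
    have h3 := sub_ne_zero.mpr hvp.symm
    exact mul_ne_zero h1 (mul_ne_zero h2 h3) this
  · rintro ⟨r, s⟩ - hrs
    by_contra hz
    simp only [mul_eq_zero, not_or, sub_eq_zero] at hz
    obtain ⟨h1, h2, h3⟩ := hz
    refine hrs ?_
    have hadj : (grid d n).Adj r s := by
      by_contra hadj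
      exact h1 (by simp [pairCond, hadj])
    rcases hiso r s hadj (Ne.symm h2) (Ne.symm h3) h1 with ⟨rfl, rfl⟩ | ⟨rfl, rfl⟩ <;> simp

/-! ### Neighbours in the grid -/

lemma exists_coord_of_adj {p q : Vertex d n} (h : (grid d n).Adj p q) :
    ∃ k, (q.1 k = p.1 k + 1 ∨ q.1 k = p.1 k - 1) ∧ ∀ l, l ≠ k → q.1 l = p.1 l := by
  have h1 : ∑ i, |p.1 i - q.1 i| = 1 := h.1
  obtain ⟨k, hk⟩ : ∃ k, p.1 k ≠ q.1 k := by
    by_contra hc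
    push Not at hc
    simp [hc] at h1
  have hs := Finset.add_sum_erase Finset.univ (fun i => |p.1 i - q.1 i|) (Finset.mem_univ k)
  have hpos : 0 < |p.1 k - q.1 k| := abs_pos.mpr (sub_ne_zero.mpr hk)
  have hnn : 0 ≤ ∑ i ∈ Finset.univ.erase k, |p.1 i - q.1 i| :=
    Finset.sum_nonneg fun _ _ => abs_nonneg _
  simp only [h1] at hs
  refine ⟨k, ?_, fun l hl => ?_⟩
  · have : |p.1 k - q.1 k| = 1 := by omega
    rcases eq_or_eq_neg_of_abs_eq this with h | h <;> omega
  · have := Finset.single_le_sum (f := fun i => |p.1 i - q.1 i|) (fun _ _ => abs_nonneg _)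
      (Finset.mem_erase.mpr ⟨hl, Finset.mem_univ l⟩)
    have h0 : |p.1 l - q.1 l| ≤ 0 := by omega
    have := abs_nonpos_iff.mp h0
    omega

lemma l1dist_add_single (p : Fin d → ℤ) (k : Fin d) {σ : ℤ} (hσ : σ = 1 ∨ σ = -1) :
    l1dist p (p + Pi.single k σ) = 1 := by
  unfold l1dist
  rw [Finset.sum_eq_single k]
  · rcases hσ with rfl | rfl <;> simp
  · intro i _ hi
    simp [hi]
  · simp

lemma adj_of_eq_add_single {p q : Vertex d n} (hp : p.1 ∈ interior d n) {k : Fin d} {σ : ℤ}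
    (hσ : σ = 1 ∨ σ = -1) (hq : q.1 = p.1 + Pi.single k σ) : (grid d n).Adj p q :=
  ⟨by rw [hq]; exact l1dist_add_single _ _ hσ,
    fun hh => not_mem_interior_of_mem_boundary hh.1 hp⟩

lemma exists_neighbor (p : Vertex d n) (hp : p.1 ∈ interior d n) (k : Fin d) {σ : ℤ}
    (hσ : σ = 1 ∨ σ = -1) : ∃ q : Vertex d n, q.1 = p.1 + Pi.single k σ := by
  have hd := l1dist_add_single p.1 k hσ
  suffices hmem : p.1 + Pi.single k σ ∈ interior d n ∪ boundary d n from ⟨⟨_, hmem⟩, rfl⟩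
  by_cases h : p.1 + Pi.single k σ ∈ interior d n
  · exact Or.inl h
  · refine Or.inr ⟨⟨p.1, hp, hd⟩, ?_⟩
    rintro _ ⟨q, hq, rfl⟩
    by_contra hlt
    apply h
    have : q = p.1 + Pi.single k σ := by
      funext i
      have h1 := abs_coord_le_l1dist q (p.1 + Pi.single k σ) i
      simp only [not_le] at hlt
      have := abs_nonpos_iff.mp (show |q i - (p.1 + Pi.single k σ : Fin d → ℤ) i| ≤ 0 by omega)
      omega
    exact this ▸ hq

/-! ### Harmonic potentials by marching -/

/-- The node `p` is `q + σ e_i` for an interior node `q`. -/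
def IsNext (i : Fin d) (σ : ℤ) (p q : Vertex d n) : Prop :=
  q.1 ∈ interior d n ∧ p.1 = q.1 + Pi.single i σ

lemma IsNext.adj {i : Fin d} {σ : ℤ} (hσ : σ = 1 ∨ σ = -1) {p q : Vertex d n}
    (h : IsNext i σ p q) : (grid d n).Adj q p :=
  adj_of_eq_add_single h.1 hσ h.2

lemma IsNext.coord_self {i : Fin d} {σ : ℤ} {p q : Vertex d n} (h : IsNext i σ p q) :
    p.1 i = q.1 i + σ := by simp [h.2]

lemma IsNext.coord_ne {i : Fin d} {σ : ℤ} {p q : Vertex d n} (h : IsNext i σ p q) {k : Fin d}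
    (hk : k ≠ i) : p.1 k = q.1 k := by simp [h.2, hk]

/-- This makes marching a recursion on the layers of σ x_i: solved for `p`, the equation at `q`
involves only earlier layers. -/
lemma IsNext.coord_lt_of_adj {i : Fin d} {σ : ℤ} (hσ : σ = 1 ∨ σ = -1) {p q r : Vertex d n}
    (h : IsNext i σ p q) (hr : (grid d n).Adj q r) (hne : r ≠ p) :
    σ * r.1 i < σ * p.1 i := by
  obtain ⟨k, hk, hl⟩ := exists_coord_of_adj hr
  have hpi := h.coord_self
  by_cases hki : k = i
  · subst hki
    by_contra hc
    apply hne
    apply Subtype.ext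
    funext l
    by_cases hlk : l = k
    · subst hlk
      rcases hσ with rfl | rfl <;> rcases hk with hk | hk <;> omega
    · rw [hl l hlk, h.coord_ne hlk]
  · have := hl i (Ne.symm hki)
    rcases hσ with rfl | rfl <;> omega

/-- If a potential balanced at `q` vanishes at `q` and its other neighbours, it vanishes at `p`. -/
lemma eq_zero_of_netCurrent_eq_zero (γ : Conductivity d n) {u : Vertex d n → ℝ}
    {p q : Vertex d n} (hpq : (grid d n).Adj q p) (h : netCurrent γ u q = 0) (hq : u q = 0)
    (h0 : ∀ r, (grid d n).Adj q r → r ≠ p → u r = 0) : u p = 0 := by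
  classical
  rw [netCurrent_apply, Finset.sum_eq_single p] at h
  · rw [hq, sub_zero] at h
    exact (mul_eq_zero.mp h).resolve_left (pairCond_pos γ hpq).ne'
  · intro r _ hr
    by_cases hadj : (grid d n).Adj q r
    · rw [h0 r hadj hr, hq, sub_zero, mul_zero]
    · simp [pairCond, hadj]
  · simp

/-- A harmonic potential that vanishes at all nodes that are not reached by marching in
direction `σ e_i` vanishes identically. -/
lemma eq_zero_of_marching (γ : Conductivity d n) {i : Fin d} {σ : ℤ} (hσ : σ = 1 ∨ σ = -1)
    {u : Vertex d n → ℝ} (hu : IsHarmonic γ u)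
    (h0 : ∀ p, (∀ q, ¬ IsNext i σ p q) → u p = 0) : u = 0 := by
  obtain ⟨B, hB⟩ : ∃ B : ℤ, ∀ p : Vertex d n, B ≤ σ * p.1 i := by
    refine ⟨-(n + 1), fun p => ?_⟩
    have := coord_mem_of_mem p.2 i
    rcases hσ with rfl | rfl <;> omega
  have key : ∀ m : ℕ, ∀ p : Vertex d n, σ * p.1 i < B + m → u p = 0 := by
    intro m
    induction m with
    | zero => intro p hp; have := hB p; omega
    | succ m ih =>
      intro p hp
      by_cases hn : ∃ q, IsNext i σ p q
      · obtain ⟨q, hq⟩ := hn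
        push_cast at hp
        refine eq_zero_of_netCurrent_eq_zero γ (hq.adj hσ) (hu q hq.1) (ih q ?_)
          fun r hr hne => ih r ?_
        · have := hq.coord_self
          rcases hσ with rfl | rfl <;> omega
        · have := hq.coord_lt_of_adj hσ hr hne
          omega
      · exact h0 p (not_exists.mp hn)
  funext p
  refine key (σ * p.1 i - B + 1).toNat p ?_
  have := hB p
  omega

/-- The harmonic potential obtained by marching in direction `σ e_i` from a unit source. -/
lemma exists_isHarmonic_single (γ : Conductivity d n) {i : Fin d} {σ : ℤ}
    (hσ : σ = 1 ∨ σ = -1) (r : Vertex d n) (hr : ∀ q, ¬ IsNext i σ r q) :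
    ∃ u, IsHarmonic γ u ∧ u r = 1 ∧ ∀ p, (∀ q, ¬ IsNext i σ p q) → p ≠ r → u p = 0 := by
  classical
  -- A square system: a reached node contributes the equation at its predecessor, any other node its
  -- value. Uniqueness by marching therefore gives existence.
  let A : (Vertex d n → ℝ) →ₗ[ℝ] (Vertex d n → ℝ) := LinearMap.pi fun p =>
    if h : ∃ q, IsNext i σ p q then (LinearMap.proj h.choose).comp (netCurrent γ)
    else LinearMap.proj p
  have hA1 : ∀ u p q, IsNext i σ p q → A u p = netCurrent γ u q := by
    intro u p q hq
    have h : ∃ q, IsNext i σ p q := ⟨q, hq⟩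
    have he : h.choose = q := Subtype.ext (add_right_cancel (h.choose_spec.2.symm.trans hq.2))
    simp only [A, LinearMap.pi_apply, dif_pos h, LinearMap.comp_apply, LinearMap.proj_apply, he]
  have hA2 : ∀ u p, (∀ q, ¬ IsNext i σ p q) → A u p = u p := by
    intro u p hp
    simp only [A, LinearMap.pi_apply, dif_neg (not_exists.mpr hp), LinearMap.proj_apply]
  have hnext : ∀ q : Vertex d n, q.1 ∈ interior d n → ∃ p, IsNext i σ p q := fun q hq =>
    (exists_neighbor q hq i hσ).imp fun p hp => ⟨hq, hp⟩
  have hinj : Function.Injective A := by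
    rw [injective_iff_map_eq_zero]
    intro u hu
    refine eq_zero_of_marching γ (i := i) hσ (fun q hq => ?_) fun p hp => ?_
    · obtain ⟨p, hp⟩ := hnext q hq
      rw [← hA1 u p q hp, hu]; rfl
    · rw [← hA2 u p hp, hu]; rfl
  obtain ⟨u, hu⟩ := LinearMap.injective_iff_surjective.mp hinj (Pi.single r 1)
  refine ⟨u, fun q hq => ?_, ?_, fun p hp hpr => ?_⟩
  · obtain ⟨p, hp⟩ := hnext q hq
    have hpr : p ≠ r := by
      rintro rfl
      exact hr q hp
    rw [← hA1 u p q hp, hu, Pi.single_eq_of_ne hpr]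
  · rw [← hA2 u r hr, hu, Pi.single_eq_same]
  · rw [← hA2 u p hp, hu, Pi.single_eq_of_ne hpr]

/-! ### Supports bounded by walls -/

/-- `p` does not lie beyond the wall through `r` orthogonal to `e_j - σ e_i`, and if it lies on
the wall then it shares the transversal coordinates of `r`. -/
def Behind (i j : Fin d) (σ : ℤ) (r p : Vertex d n) : Prop :=
  p.1 j - σ * p.1 i ≤ r.1 j - σ * r.1 i ∧
    (p.1 j - σ * p.1 i = r.1 j - σ * r.1 i → ∀ k, k ≠ i → k ≠ j → p.1 k = r.1 k)

/-- The region behind a wall is preserved by one marching step. -/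
lemma Behind.of_isNext {i j : Fin d} (hij : i ≠ j) {σ : ℤ} (hσ : σ = 1 ∨ σ = -1)
    {r p q s : Vertex d n} (hq : IsNext i σ p q) (hs : s = q ∨ (grid d n).Adj q s)
    (hne : s ≠ p) (h : Behind i j σ r s) : Behind i j σ r p := by
  have hpi := hq.coord_self
  have hpj := hq.coord_ne hij.symm
  obtain ⟨h1, h2⟩ := h
  -- Put f = x_j - σ x_i. Then f(q) = f(p) + 1, so every admissible `s` has f(s) ≥ f(p), with
  -- equality only for s = q - e_j, which keeps the transversal coordinates.
  have hσ1 : σ * p.1 i = σ * q.1 i + 1 := by rcases hσ with rfl | rfl <;> omega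
  rcases hs with rfl | hs
  · exact ⟨by omega, fun he => by omega⟩
  · have hlt := hq.coord_lt_of_adj hσ hs hne
    obtain ⟨k, hk, hl⟩ := exists_coord_of_adj hs
    by_cases hkj : k = j
    · subst hkj
      have hi := hl i hij
      rw [hi] at h1 h2
      refine ⟨by omega, fun he l hli hlk => ?_⟩
      rw [hq.coord_ne hli, ← hl l hlk]
      exact h2 (by omega) l hli hlk
    · have hj := hl j (Ne.symm hkj)
      exact ⟨by omega, fun he => by omega⟩

/-- Induction on layers: if a reached node is not behind the wall, neither are its predecessor nor
the other neighbours of that predecessor. All of these vanish, hence so does the node. -/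
lemma behind_of_ne_zero (γ : Conductivity d n) {i j : Fin d} (hij : i ≠ j) {σ : ℤ}
    (hσ : σ = 1 ∨ σ = -1) {r : Vertex d n} {u : Vertex d n → ℝ} (hu : IsHarmonic γ u)
    (h0 : ∀ p, (∀ q, ¬ IsNext i σ p q) → p ≠ r → u p = 0) (p : Vertex d n) (hp : u p ≠ 0) :
    Behind i j σ r p := by
  obtain ⟨B, hB⟩ : ∃ B : ℤ, ∀ p : Vertex d n, B ≤ σ * p.1 i := by
    refine ⟨-(n + 1), fun p => ?_⟩
    have := coord_mem_of_mem p.2 i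
    rcases hσ with rfl | rfl <;> omega
  have key : ∀ m : ℕ, ∀ p : Vertex d n, σ * p.1 i < B + m → u p ≠ 0 → Behind i j σ r p := by
    intro m
    induction m with
    | zero => intro p hp; have := hB p; omega
    | succ m ih =>
      intro p hp hup
      by_cases hn : ∃ q, IsNext i σ p q
      · obtain ⟨q, hq⟩ := hn
        push_cast at hp
        by_contra hb
        have hqp : q ≠ p := (hq.adj hσ).ne
        refine hup (eq_zero_of_netCurrent_eq_zero γ (hq.adj hσ) (hu q hq.1) ?_
          fun s hs hne => ?_)
        · by_contra hz
          refine hb (Behind.of_isNext hij hσ hq (Or.inl rfl) hqp (ih q ?_ hz))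
          have := hq.coord_self
          rcases hσ with rfl | rfl <;> omega
        · by_contra hz
          refine hb (Behind.of_isNext hij hσ hq (Or.inr hs) hne (ih s ?_ hz))
          have := hq.coord_lt_of_adj hσ hs hne
          omega
      · by_cases hpr : p = r
        · subst hpr
          exact ⟨le_rfl, fun _ _ _ _ => rfl⟩
        · exact absurd (h0 p (not_exists.mp hn) hpr) hup
  refine key (σ * p.1 i - B + 1).toNat p ?_ hp
  have := hB p
  omega

/-- For every node `r` there is a harmonic potential that does not vanish at `r`, vanishes beyond
the wall through `r`, and is supported on a single diagonal on that wall. -/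
lemma exists_isHarmonic_behind (γ : Conductivity d n) {i j : Fin d} (hij : i ≠ j) {σ : ℤ}
    (hσ : σ = 1 ∨ σ = -1) (r : Vertex d n) :
    ∃ u, IsHarmonic γ u ∧ u r ≠ 0 ∧ ∀ p, u p ≠ 0 → Behind i j σ r p := by
  -- Descend along the wall by s = r - σ e_i - e_j until a free node is met. This happens at the
  -- latest when `r.1 j ≤ 0`, since a predecessor would share that coordinate and be interior.
  obtain ⟨m, hm⟩ : ∃ m : ℕ, r.1 j ≤ m := ⟨(r.1 j).toNat, by omega⟩
  induction m generalizing r with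
  | zero =>
    obtain ⟨u, hu, hr, h0⟩ := exists_isHarmonic_single γ hσ (i := i) r (fun q hq => by
      have := hq.coord_ne hij.symm
      have := hq.1 j
      omega)
    exact ⟨u, hu, by simp [hr], behind_of_ne_zero γ hij hσ hu h0⟩
  | succ m ih =>
    by_cases hn : ∃ q, IsNext i σ r q
    · obtain ⟨q, hq⟩ := hn
      obtain ⟨s, hs⟩ := exists_neighbor q hq.1 j (σ := -1) (Or.inr rfl)
      have hadj := adj_of_eq_add_single hq.1 (Or.inr rfl) hs
      have hsj : s.1 j = q.1 j - 1 := by rw [hs]; simp; ring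
      have hsk : ∀ k, k ≠ j → s.1 k = q.1 k := fun k hk => by simp [hs, hk]
      have hri := hq.coord_self
      have hrj := hq.coord_ne hij.symm
      have hσ1 : σ * r.1 i = σ * q.1 i + 1 := by rcases hσ with rfl | rfl <;> omega
      have hsi := hsk i hij
      obtain ⟨u, hu, hus, hb⟩ := ih s (by push_cast at hm; omega)
      have hwall : s.1 j - σ * s.1 i = r.1 j - σ * r.1 i := by rw [hsi]; omega
      refine ⟨u, hu, fun hur => hus ?_, fun p hp => ?_⟩
      -- At `q`, which lies beyond the wall, `r` and `s` are the only neighbours not beyond it, so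
      -- vanishing at `r` would force vanishing at `s`.
      · refine eq_zero_of_netCurrent_eq_zero γ hadj (hu q hq.1) ?_ fun t ht hne => ?_
        · by_contra hz
          have := (hb q hz).1
          omega
        · by_contra hz
          have htr : t ≠ r := by
            rintro rfl
            exact hz hur
          have hlt := hq.coord_lt_of_adj hσ ht htr
          have h1 := (hb t hz).1
          obtain ⟨k, hk, hl⟩ := exists_coord_of_adj ht
          by_cases hkj : k = j
          · subst hkj
            rw [hl i hij] at h1
            have htk : t.1 k = q.1 k - 1 := by omega
            apply hne
            apply Subtype.ext
            funext l
            by_cases hlk : l = k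
            · rw [hlk, htk, hsj]
            · rw [hl l hlk, hsk l hlk]
          · have := hl j (Ne.symm hkj)
            omega
      · obtain ⟨h1, h2⟩ := hb p hp
        refine ⟨by omega, fun he k hki hkj => ?_⟩
        rw [h2 (by omega) k hki hkj, hsk k hkj, hq.coord_ne hki]
    · obtain ⟨u, hu, hr, h0⟩ := exists_isHarmonic_single γ hσ r (not_exists.mp hn)
      exact ⟨u, hu, by simp [hr], behind_of_ne_zero γ hij hσ hu h0⟩

/-! ### Wedges and the edges at their top -/

lemma vertex_ext {i j : Fin d} {p q : Vertex d n} (hi : p.1 i = q.1 i) (hj : p.1 j = q.1 j)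
    (hk : ∀ k, k ≠ i → k ≠ j → p.1 k = q.1 k) : p = q := by
  apply Subtype.ext
  funext k
  by_cases h1 : k = i
  · rw [h1, hi]
  by_cases h2 : k = j
  · rw [h2, hj]
  exact hk k h1 h2

/-- The three kinds of edges relative to two distinct coordinates. -/
lemma adj_cases {i j : Fin d} (hij : i ≠ j) {p q : Vertex d n} (h : (grid d n).Adj p q) :
    ((q.1 i = p.1 i + 1 ∨ q.1 i = p.1 i - 1) ∧ q.1 j = p.1 j ∧
        ∀ k, k ≠ i → k ≠ j → q.1 k = p.1 k) ∨
      (q.1 i = p.1 i ∧ (q.1 j = p.1 j + 1 ∨ q.1 j = p.1 j - 1) ∧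
        ∀ k, k ≠ i → k ≠ j → q.1 k = p.1 k) ∨
      (q.1 i = p.1 i ∧ q.1 j = p.1 j ∧ ∃ k, k ≠ i ∧ k ≠ j ∧ q.1 k ≠ p.1 k) := by
  obtain ⟨k, hk, hl⟩ := exists_coord_of_adj h
  by_cases hki : k = i
  · subst hki
    exact Or.inl ⟨hk, hl j hij.symm, fun l h1 _ => hl l h1⟩
  by_cases hkj : k = j
  · subst hkj
    exact Or.inr (Or.inl ⟨hl i hij, hk, fun l _ h1 => hl l h1⟩)
  · exact Or.inr (Or.inr ⟨hl i (Ne.symm hki), hl j (Ne.symm hkj), k, hki, hkj, by omega⟩)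

lemma exists_coord_pos_of_adj {j : Fin d} {p q : Vertex d n} (h : (grid d n).Adj p q) :
    0 < p.1 j ∨ 0 < q.1 j := by
  by_contra hc
  push Not at hc
  refine h.2 ⟨p.2.resolve_left fun hp => ?_, q.2.resolve_left fun hq => ?_⟩
  · have := (hp j).1
    omega
  · have := (hq j).1
    omega

/-- Some endpoint of the edge `{r, s}` lies in the wedge side `x_j ≤ x_i - a`, and some endpoint
lies in the wedge side `x_j ≤ b - x_i`. -/
def MeetsWedge (i j : Fin d) (a b : ℤ) (r s : Vertex d n) : Prop :=
  (∃ e, (e = r ∨ e = s) ∧ e.1 j ≤ e.1 i - a) ∧ ∃ e, (e = r ∨ e = s) ∧ e.1 j ≤ b - e.1 i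

/-- Every edge that meets a strictly smaller wedge has matching conductivities. -/
def AgreesBelow (i j : Fin d) (a b : ℤ) (γ₁ γ₂ : Conductivity d n) : Prop :=
  ∀ r s, (grid d n).Adj r s → MeetsWedge i j (a + 1) b r s ∨ MeetsWedge i j a (b - 1) r s →
    pairCond γ₁ r s = pairCond γ₂ r s

/-- An endpoint strictly below one wall would place the edge in a smaller wedge, where the
conductivities already agree. -/
lemma AgreesBelow.le_coord {i j : Fin d} {a b : ℤ} {γ₁ γ₂ : Conductivity d n}
    (H : AgreesBelow i j a b γ₁ γ₂) {r s : Vertex d n} (hadj : (grid d n).Adj r s)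
    (hm : MeetsWedge i j a b r s) (hne : pairCond γ₁ r s ≠ pairCond γ₂ r s)
    (e : Vertex d n) (he : e = r ∨ e = s) : e.1 i - a ≤ e.1 j ∧ b - e.1 i ≤ e.1 j := by
  constructor
  · by_contra hc
    exact hne (H r s hadj (Or.inl ⟨⟨e, he, by omega⟩, hm.2⟩))
  · by_contra hc
    exact hne (H r s hadj (Or.inr ⟨hm.1, ⟨e, he, by omega⟩⟩))

/-- Test potentials for a node `p` on the wall `x_j = x_i - a` and a node `p'` on the wall
`x_j = b - x_i`. Edges with a nonzero contribution to the difference of energies touch both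
walls on the transversal lines through `p` and `p'`. -/
lemma AgreesBelow.exists_potentials {i j : Fin d} (hij : i ≠ j) {a b : ℤ}
    {γ₁ γ₂ : Conductivity d n} (H : AgreesBelow i j a b γ₁ γ₂) {p p' : Vertex d n}
    (hp : p.1 j = p.1 i - a) (hp' : p'.1 j = b - p'.1 i) :
    ∃ u v, IsHarmonic γ₁ u ∧ IsHarmonic γ₂ v ∧ u p ≠ 0 ∧ v p' ≠ 0 ∧
      (∀ x, u x ≠ 0 → Behind i j 1 p x) ∧ (∀ x, v x ≠ 0 → Behind i j (-1) p' x) ∧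
      ∀ r s, (grid d n).Adj r s → u r ≠ u s → v r ≠ v s →
        pairCond γ₁ r s ≠ pairCond γ₂ r s →
        (∀ e, e = r ∨ e = s → e.1 i - a ≤ e.1 j ∧ b - e.1 i ≤ e.1 j) ∧
        ∃ e e', (e = r ∨ e = s) ∧ (e' = r ∨ e' = s) ∧ e.1 j = e.1 i - a ∧ e'.1 j = b - e'.1 i ∧
          (∀ k, k ≠ i → k ≠ j → e.1 k = p.1 k) ∧ (∀ k, k ≠ i → k ≠ j → e'.1 k = p'.1 k) := by
  obtain ⟨u, hu, hup, hub⟩ := exists_isHarmonic_behind γ₁ hij (σ := 1) (Or.inl rfl) p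
  obtain ⟨v, hv, hvp, hvb⟩ := exists_isHarmonic_behind γ₂ hij (σ := -1) (Or.inr rfl) p'
  refine ⟨u, v, hu, hv, hup, hvp, hub, hvb, fun r s hadj hur hvr hne => ?_⟩
  have exists_end : ∀ w : Vertex d n → ℝ, w r ≠ w s → ∃ e, (e = r ∨ e = s) ∧ w e ≠ 0 := by
    intro w hw
    by_cases hr : w r = 0
    · exact ⟨s, Or.inr rfl, fun hs => hw (hr.trans hs.symm)⟩
    · exact ⟨r, Or.inl rfl, hr⟩
  obtain ⟨e, he, hue⟩ := exists_end u hur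
  obtain ⟨e', he', hve⟩ := exists_end v hvr
  obtain ⟨h1, h2⟩ := hub e hue
  obtain ⟨h3, h4⟩ := hvb e' hve
  -- The supports put `e` and `e'` on or below their walls and `le_coord` puts them on or above, so
  -- both lie exactly on the walls.
  have hall := H.le_coord hadj ⟨⟨e, he, by omega⟩, ⟨e', he', by omega⟩⟩ hne
  have h5 := hall e he
  have h6 := hall e' he'
  exact ⟨hall, e, e', he, he', by omega, by omega, h2 (by omega), h4 (by omega)⟩

lemma eq_zero_of_not_behind {i j : Fin d} {σ : ℤ} {p x : Vertex d n} {u : Vertex d n → ℝ}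
    (hub : ∀ x, u x ≠ 0 → Behind i j σ p x) (hx : ¬ Behind i j σ p x) : u x = 0 := by
  by_contra hz
  exact hx (hub x hz)

lemma adj_of_mem_of_ne {r s e e' : Vertex d n} (h : (grid d n).Adj r s) (he : e = r ∨ e = s)
    (he' : e' = r ∨ e' = s) (hne : e ≠ e') : (grid d n).Adj e e' := by
  rcases he with rfl | rfl <;> rcases he' with rfl | rfl
  · exact absurd rfl hne
  · exact h
  · exact h.symm
  · exact absurd rfl hne

/-- Edges in direction `e_i` joining the two walls. -/
lemma AgreesBelow.pairCond_eq_of_march [NeZero d] {i j : Fin d} (hij : i ≠ j) {a b : ℤ}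
    {γ₁ γ₂ : Conductivity d n} (h : dtnMatrix γ₁ = dtnMatrix γ₂)
    (H : AgreesBelow i j a b γ₁ γ₂) {p p' : Vertex d n}
    (hp : p.1 j = p.1 i - a) (hp' : p'.1 j = b - p'.1 i) (hi : p.1 i = p'.1 i + 1)
    (hj : p.1 j = p'.1 j) (hk : ∀ k, k ≠ i → k ≠ j → p.1 k = p'.1 k) :
    pairCond γ₁ p p' = pairCond γ₂ p p' := by
  obtain ⟨u, v, hu, hv, hup, hvp, hub, hvb, hiso⟩ := H.exists_potentials hij hp hp'
  have hu0 : u p' = 0 := eq_zero_of_not_behind hub fun hb => by have := hb.1; omega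
  have hv0 : v p = 0 := eq_zero_of_not_behind hvb fun hb => by have := hb.1; omega
  refine pairCond_eq_of_isolated h hu hv (by rwa [hu0]) (by rw [hv0]; exact hvp.symm)
    fun r s hadj hur hvr hne => ?_
  obtain ⟨hall, e, e', he, he', hea, heb, hek, hek'⟩ := hiso r s hadj hur hvr hne
  have h1 := hall e he
  have h2 := hall e' he'
  -- Parity: the positions of `p` and `p'` make b - a odd, whereas a node on both walls has 2 x_j =
  -- b - a.
  have hee : e ≠ e' := by
    rintro rfl
    omega
  have hE : e = p ∧ e' = p' := by
    rcases adj_cases hij (adj_of_mem_of_ne hadj he he' hee) with ⟨c1, c2, -⟩ | ⟨c1, c2, -⟩ |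
      ⟨c1, c2, -⟩
    · exact ⟨vertex_ext (i := i) (j := j) (by omega) (by omega) hek,
        vertex_ext (i := i) (j := j) (by omega) (by omega) hek'⟩
    · omega
    · omega
  obtain ⟨rfl, rfl⟩ := hE
  rcases he with rfl | rfl <;> rcases he' with rfl | rfl
  · exact absurd rfl hee
  · exact Or.inl ⟨rfl, rfl⟩
  · exact Or.inr ⟨rfl, rfl⟩
  · exact absurd rfl hee

/-- Edges along the ridge, transversal to both `e_i` and `e_j`. -/
lemma AgreesBelow.pairCond_eq_of_ridge [NeZero d] {i j : Fin d} (hij : i ≠ j) {a b : ℤ}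
    {γ₁ γ₂ : Conductivity d n} (h : dtnMatrix γ₁ = dtnMatrix γ₂)
    (H : AgreesBelow i j a b γ₁ γ₂) {p p' : Vertex d n}
    (hp : p.1 j = p.1 i - a) (hp' : p'.1 j = b - p'.1 i) (hi : p.1 i = p'.1 i)
    (hj : p.1 j = p'.1 j) {k : Fin d} (hki : k ≠ i) (hkj : k ≠ j) (hk : p.1 k ≠ p'.1 k) :
    pairCond γ₁ p p' = pairCond γ₂ p p' := by
  obtain ⟨u, v, hu, hv, hup, hvp, hub, hvb, hiso⟩ := H.exists_potentials hij hp hp'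
  have hu0 : u p' = 0 := eq_zero_of_not_behind hub fun hb =>
    hk (hb.2 (by omega) k hki hkj).symm
  have hv0 : v p = 0 := eq_zero_of_not_behind hvb fun hb =>
    hk (hb.2 (by omega) k hki hkj)
  refine pairCond_eq_of_isolated h hu hv (by rwa [hu0]) (by rw [hv0]; exact hvp.symm)
    fun r s hadj hur hvr hne => ?_
  obtain ⟨hall, e, e', he, he', hea, heb, hek, hek'⟩ := hiso r s hadj hur hvr hne
  have h1 := hall e he
  have h2 := hall e' he'
  have hee : e ≠ e' := by
    rintro rfl
    exact hk ((hek k hki hkj).symm.trans (hek' k hki hkj))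
  have hE : e = p ∧ e' = p' := by
    rcases adj_cases hij (adj_of_mem_of_ne hadj he he' hee) with ⟨c1, c2, -⟩ | ⟨c1, c2, -⟩ |
      ⟨c1, c2, -⟩
    · omega
    · omega
    · exact ⟨vertex_ext (i := i) (j := j) (by omega) (by omega) hek,
        vertex_ext (i := i) (j := j) (by omega) (by omega) hek'⟩
  obtain ⟨rfl, rfl⟩ := hE
  rcases he with rfl | rfl <;> rcases he' with rfl | rfl
  · exact absurd rfl hee
  · exact Or.inl ⟨rfl, rfl⟩
  · exact Or.inr ⟨rfl, rfl⟩
  · exact absurd rfl hee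

/-- Edges that leave the ridge in direction `e_j`. -/
lemma AgreesBelow.pairCond_eq_of_up [NeZero d] {i j : Fin d} (hij : i ≠ j) {a b : ℤ}
    {γ₁ γ₂ : Conductivity d n} (h : dtnMatrix γ₁ = dtnMatrix γ₂)
    (H : AgreesBelow i j a b γ₁ γ₂) {p q : Vertex d n}
    (hp : p.1 j = p.1 i - a) (hp' : p.1 j = b - p.1 i) (hi : q.1 i = p.1 i)
    (hj : q.1 j = p.1 j + 1) (hk : ∀ k, k ≠ i → k ≠ j → q.1 k = p.1 k) :
    pairCond γ₁ p q = pairCond γ₂ p q := by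
  obtain ⟨u, v, hu, hv, hup, hvp, hub, hvb, hiso⟩ := H.exists_potentials hij hp hp'
  have hu0 : u q = 0 := eq_zero_of_not_behind hub fun hb => by have := hb.1; omega
  have hv0 : v q = 0 := eq_zero_of_not_behind hvb fun hb => by have := hb.1; omega
  refine pairCond_eq_of_isolated h hu hv (by rwa [hu0]) (by rwa [hv0])
    fun r s hadj hur hvr hne => ?_
  obtain ⟨hall, e, e', he, he', hea, heb, hek, hek'⟩ := hiso r s hadj hur hvr hne
  have hee : e = e' := by
    by_contra hee
    have h1 := hall e he
    have h2 := hall e' he'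
    rcases adj_cases hij (adj_of_mem_of_ne hadj he he' hee) with ⟨c1, c2, -⟩ | ⟨c1, c2, -⟩ |
      ⟨-, -, k, hki, hkj, hkne⟩
    · omega
    · omega
    · exact hkne ((hek' k hki hkj).trans (hek k hki hkj).symm)
  subst hee
  obtain rfl : e = p := vertex_ext (i := i) (j := j) (by omega) (by omega) hek
  -- From a ridge node, steps along ±e_i or -e_j fall below a wall, and transversal edges are
  -- settled by `pairCond_eq_of_ridge`. Only the upward edge is left.
  have other : ∀ f, (f = r ∨ f = s) → (grid d n).Adj e f →
      pairCond γ₁ e f ≠ pairCond γ₂ e f → f = q := by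
    intro f hf hadj' hne'
    have h1 := hall f hf
    rcases adj_cases hij hadj' with ⟨c1, c2, -⟩ | ⟨c1, c2, c3⟩ | ⟨c1, c2, k, hki, hkj, hkne⟩
    · omega
    · exact vertex_ext (i := i) (j := j) (by omega) (by omega) fun k hki hkj =>
        (c3 k hki hkj).trans (hk k hki hkj).symm
    · exact absurd (H.pairCond_eq_of_ridge hij h hea (by omega) c1.symm c2.symm hki hkj
        hkne.symm) hne'
  rcases he with rfl | rfl
  · exact Or.inl ⟨rfl, other s (Or.inr rfl) hadj hne⟩
  · exact Or.inr ⟨other r (Or.inl rfl) hadj.symm (by simpa only [pairCond_comm _ _ r] using hne),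
      rfl⟩

/-- The induction step: agreement below the wedge gives agreement on the wedge. -/
lemma AgreesBelow.pairCond_eq [NeZero d] {i j : Fin d} (hij : i ≠ j) {a b : ℤ}
    {γ₁ γ₂ : Conductivity d n} (h : dtnMatrix γ₁ = dtnMatrix γ₂)
    (H : AgreesBelow i j a b γ₁ γ₂) {r s : Vertex d n} (hadj : (grid d n).Adj r s)
    (hm : MeetsWedge i j a b r s) : pairCond γ₁ r s = pairCond γ₂ r s := by
  by_contra hne
  have hall := H.le_coord hadj hm hne
  obtain ⟨⟨e, he, hea⟩, ⟨e', he', heb⟩⟩ := hm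
  have h1 := hall e he
  have h2 := hall e' he'
  have pair : ∀ f f', (f = r ∨ f = s) → (f' = r ∨ f' = s) → f ≠ f' →
      pairCond γ₁ f f' ≠ pairCond γ₂ f f' := by
    rintro f f' (rfl | rfl) (rfl | rfl) hff
    · exact absurd rfl hff
    · exact hne
    · rwa [pairCond_comm γ₁, pairCond_comm γ₂]
    · exact absurd rfl hff
  by_cases hee : e = e'
  · subst hee
    obtain ⟨f, hf, hfe⟩ : ∃ f, (f = r ∨ f = s) ∧ e ≠ f := by
      rcases he with rfl | rfl
      · exact ⟨s, Or.inr rfl, hadj.ne⟩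
      · exact ⟨r, Or.inl rfl, hadj.ne'⟩
    have h3 := hall f hf
    refine pair e f he hf hfe ?_
    rcases adj_cases hij (adj_of_mem_of_ne hadj he hf hfe) with ⟨c1, c2, -⟩ | ⟨c1, c2, c3⟩ |
      ⟨c1, c2, k, hki, hkj, hkne⟩
    · omega
    · exact H.pairCond_eq_of_up hij h (by omega) (by omega) c1 (by omega) c3
    · exact H.pairCond_eq_of_ridge hij h (by omega) (by omega) c1.symm c2.symm hki hkj hkne.symm
  · refine pair e e' he he' hee ?_
    rcases adj_cases hij (adj_of_mem_of_ne hadj he he' hee) with ⟨c1, c2, c3⟩ | ⟨c1, c2, -⟩ |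
      ⟨c1, c2, k, hki, hkj, hkne⟩
    · exact H.pairCond_eq_of_march hij h (by omega) (by omega) (by omega) c2.symm
        fun k hki hkj => (c3 k hki hkj).symm
    · omega
    · exact H.pairCond_eq_of_ridge hij h (by omega) (by omega) c1.symm c2.symm hki hkj hkne.symm

lemma pairCond_eq_of_meetsWedge [NeZero d] {i j : Fin d} (hij : i ≠ j)
    {γ₁ γ₂ : Conductivity d n} (h : dtnMatrix γ₁ = dtnMatrix γ₂) (L : ℕ) (a b : ℤ)
    (hL : b - a + 1 = L) {r s : Vertex d n} (hadj : (grid d n).Adj r s)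
    (hm : MeetsWedge i j a b r s) : pairCond γ₁ r s = pairCond γ₂ r s := by
  induction L generalizing a b r s with
  | zero =>
    -- Here b = a - 1. The wedge can be met only by an e_i-edge with x_j = 0 at both ends, but then
    -- both ends are boundary nodes.
    exfalso
    obtain ⟨⟨e, he, hea⟩, ⟨e', he', heb⟩⟩ := hm
    have h1 := (coord_mem_of_mem e.2 j).1
    have h2 := (coord_mem_of_mem e'.2 j).1
    push_cast at hL
    by_cases hee : e = e'
    · subst hee
      omega
    · have hadj' := adj_of_mem_of_ne hadj he he' hee
      have hpos := exists_coord_pos_of_adj (j := j) hadj'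
      rcases adj_cases hij hadj' with ⟨c1, c2, -⟩ | ⟨c1, c2, -⟩ | ⟨c1, c2, -⟩ <;> omega
  | succ L ih =>
    push_cast at hL
    refine AgreesBelow.pairCond_eq hij h (fun r s hadj hrs => ?_) hadj hm
    rcases hrs with hrs | hrs
    · exact ih (a + 1) b (by omega) hadj hrs
    · exact ih a (b - 1) (by omega) hadj hrs

end

end GridCalderon

theorem theorem1 (d n : ℕ) [NeZero d] (hd : 2 ≤ d)
    (γ₁ γ₂ : GridCalderon.Conductivity d n)
    (h : GridCalderon.dtnMatrix γ₁ = GridCalderon.dtnMatrix γ₂) :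
    γ₁ = γ₂ := by
  open GridCalderon in
  apply Subtype.ext
  funext ⟨e, he⟩
  induction e using Sym2.ind with
  | _ p q =>
    have hadj : (grid d n).Adj p q := he
    have hij : (⟨0, by omega⟩ : Fin d) ≠ ⟨1, by omega⟩ := by simp
    have h0 := coord_mem_of_mem p.2 ⟨0, by omega⟩
    have h1 := coord_mem_of_mem p.2 ⟨1, by omega⟩
    -- Coordinates range over 0, …, n + 1, so every node satisfies both wedge inequalities for this
    -- `a` and `b`; the length is b - a + 1 = 4n + 5.
    have := pairCond_eq_of_meetsWedge hij h (4 * n + 5) (-(n + 1)) (3 * n + 3)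
      (by push_cast; ring) hadj ⟨⟨p, Or.inl rfl, by omega⟩, ⟨p, Or.inl rfl, by omega⟩⟩
    rwa [pairCond_of_adj _ hadj, pairCond_of_adj _ hadj] at this
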